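/- Let $F$ be a field of characteristic $\neq 2$ and $A$ an $F$-algebra, not necessarily associative, commutative or unital. For $a\in A$ and $\mu\in F$ put $A_\mu(L_a)=\{x: ax=\mu x\}$ and $A_\mu(R_a)=\{x: xa=\mu x\}$. A nonzero idempotent $a=a^2\in A$ is called a primitive axis of $A$ if there are $\lambda,\delta\in F\setminus\{0,1\}$ such that (i) $A=\big(A_1(L_a)\oplus A_0(L_a)\big)\oplus A_\lambda(L_a)$ and $A=\big(A_1(R_a)\oplus A_0(R_a)\big)\oplus A_\delta(R_a)$, and each of the two decompositions is a $\mathbb Z/2$-grading of the algebra $A$, with even part in brackets (the spaces $A_\lambda(L_a)$, $A_\delta(R_a)$ may be zero); (ii) $a(ya)=(ay)a$ for all $y\in A$; (iii) $A_1(L_a)=Fa=A_1(R_a)$; (iv) $A_\lambda(L_a)\cap A_0(R_a)=0=A_0(L_a)\cap A_\delta(R_a)$. Theorem. Suppose that $A$ is generated as an $F$-algebra by two primitive axes $a,b$ of $A$ (no relation between their types is assumed). Then every idempotent of $A$ that is distinct from $0$ and from the identity element of $A$ (if $A$ has one) is a primitive axis of $A$. -/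

import Mathlib

section PrimitiveAxes

variable {F A : Type*} [Field F] [NonUnitalNonAssocRing A] [Module F A]

/-- `A = P ⊕ M` is a `ℤ/2`-grading of the (nonassociative) algebra `A`, with even part `P`
and odd part `M`. -/
structure IsZ2Grading (P M : Submodule F A) : Prop where
  isCompl : IsCompl P M
  even_even : ∀ x ∈ P, ∀ y ∈ P, x * y ∈ P
  even_odd : ∀ x ∈ P, ∀ y ∈ M, x * y ∈ M
  odd_even : ∀ x ∈ M, ∀ y ∈ P, x * y ∈ M
  odd_odd : ∀ x ∈ M, ∀ y ∈ M, x * y ∈ P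

variable [IsScalarTower F A A] [SMulCommClass F A A]

/-- `A_μ(L_a)`: the eigenspace for `μ` of left multiplication `x ↦ a * x`. -/
def leftEigenspace (a : A) (μ : F) : Submodule F A :=
  Module.End.eigenspace (LinearMap.mulLeft F a) μ

/-- `A_μ(R_a)`: the eigenspace for `μ` of right multiplication `x ↦ x * a`. -/
def rightEigenspace (a : A) (μ : F) : Submodule F A :=
  Module.End.eigenspace (LinearMap.mulRight F a) μ

/-- `a` is a left axis of type `lam`: a nonzero idempotent such that
`A = (A_1(L_a) ⊕ A_0(L_a)) ⊕ A_lam(L_a)` is a `ℤ/2`-grading. (Eigenspaces for different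
eigenvalues are automatically independent; `A_lam(L_a)` may be zero.) -/
structure IsLeftAxis (a : A) (lam : F) : Prop where
  ne_zero : a ≠ 0
  idem : a * a = a
  lam_ne_zero : lam ≠ 0
  lam_ne_one : lam ≠ 1
  grading : IsZ2Grading (leftEigenspace a (1 : F) ⊔ leftEigenspace a (0 : F))
    (leftEigenspace a lam)

/-- `a` is a right axis of type `del`. -/
structure IsRightAxis (a : A) (del : F) : Prop where
  ne_zero : a ≠ 0
  idem : a * a = a
  del_ne_zero : del ≠ 0
  del_ne_one : del ≠ 1
  grading : IsZ2Grading (rightEigenspace a (1 : F) ⊔ rightEigenspace a (0 : F))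
    (rightEigenspace a del)

/-- `a` is a primitive axis of type `(lam, del)`. The left and the right `ℤ/2`-grading, together
with the commutation of `L_a` and `R_a`, amount to the `ℤ/2 × ℤ/2`-grading of `A` by the
joint eigenspaces; the last two fields say that the two mixed joint eigenspaces vanish, so that
`A = F a ⊕ A_{0,0}(a) ⊕ A_{lam,del}(a)`. -/
structure IsPrimitiveAxisOfType (a : A) (lam del : F) : Prop where
  left : IsLeftAxis a lam
  right : IsRightAxis a del
  comm : ∀ y : A, a * (y * a) = (a * y) * a
  left_primitive : leftEigenspace a (1 : F) = Submodule.span F {a}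
  right_primitive : rightEigenspace a (1 : F) = Submodule.span F {a}
  lam_zero : leftEigenspace a lam ⊓ rightEigenspace a (0 : F) = ⊥
  zero_del : leftEigenspace a (0 : F) ⊓ rightEigenspace a del = ⊥

variable (F) in
/-- `a` is a primitive axis of the `F`-algebra `A`, of some type. -/
def IsPrimitiveAxis (a : A) : Prop :=
  ∃ lam del : F, IsPrimitiveAxisOfType a lam del

end PrimitiveAxes

/-! ### Multiplication tables relative to an idempotent -/

section AxisTables

variable {F A : Type*} [Field F] [NonUnitalNonAssocRing A] [Module F A]

/-! Write `b = β a + c + x` with `c` in the joint eigenspace (0, 0) of `a` and `x` in the joint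
eigenspace of the type of `a`. The span of `a`, `c`, `x` is also the span of `a`, `b`, `a * b`,
hence of the components of `a` relative to `b`. It is therefore stable under left multiplication by
`b`, and the grading of `a` separates `b * c` and `b * x` into products of components. So the span
is closed under multiplication and `A` has dimension at most three
(`IsPrimitiveAxisOfType.exists_axisTable`).

Conversely, a spanning table of the same shape around a nonzero idempotent, with eigenvalues other
than 0 and 1, already makes it a primitive axis (`AxisTable.isPrimitiveAxisOfType`). It remains to
know the algebras and to exhibit such a table at each idempotent.

Comparing the tables of `a` and `b` (`AxisTable.coord_relations`, `AxisTable.square_relation`)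
leaves a short list: `F`, `F × F`, two kinds of algebra of dimension two, and in dimension three a
noncommutative family with `x * x = 0`, Jordan algebras for eigenvalue 1/2, and algebras related to
`3C(l)`. In each one the idempotent equations are solved in coordinates, and every solution other
than zero and the identity gets a table with explicit complementary and odd vectors. -/

/-- `A` is spanned by `a`, `c`, `x`, where `a` is an idempotent with joint eigenvectors `c`
(for `(0, 0)`) and `x` (for `(l, d)`), and the remaining products respect the `ℤ/2`-grading in
which `a`, `c` are even and `x` is odd. -/
structure AxisTable (a c x : A) (l d u v p q s t : F) : Prop where
  aa : a * a = a
  ac : a * c = 0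
  ca : c * a = 0
  ax : a * x = l • x
  xa : x * a = d • x
  cc : c * c = u • a + v • c
  cx : c * x = p • x
  xc : x * c = q • x
  xx : x * x = s • a + t • c
  spans : ∀ z : A, ∃ i j k : F, z = i • a + j • c + k • x

theorem mem_leftEigenspace [IsScalarTower F A A] [SMulCommClass F A A] {a : A} {μ : F} {x : A} :
    x ∈ leftEigenspace a μ ↔ a * x = μ • x := by
  simp [leftEigenspace]

theorem mem_rightEigenspace [IsScalarTower F A A] [SMulCommClass F A A] {a : A} {μ : F} {x : A} :
    x ∈ rightEigenspace a μ ↔ x * a = μ • x := by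
  simp [rightEigenspace]

namespace AxisTable

variable {a c x : A} {l d u v p q s t : F}

/-- Exchange of `a` and `c` when `a + c` is an identity element. -/
theorem swap (T : AxisTable a c x l d 0 1 p q s t) : AxisTable c a x p q 0 1 l d t s where
  aa := by simp [T.cc]
  ac := T.ca
  ca := T.ac
  ax := T.cx
  xa := T.xc
  cc := by simp [T.aa]
  cx := T.ax
  xc := T.xa
  xx := by rw [T.xx, add_comm]
  spans z := by
    obtain ⟨i, j, k, rfl⟩ := T.spans z
    exact ⟨j, i, k, by module⟩

theorem mul_eq_left [SMulCommClass F A A] {b : A} {β : F}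
    (T : AxisTable a c x l d u v p q s t) (hb : b = β • a + c + x) :
    a * b = β • a + l • x := by
  rw [hb, mul_add, mul_add, mul_smul_comm, T.aa, T.ac, T.ax, add_zero]

theorem mul_eq_right [IsScalarTower F A A] {b : A} {β : F}
    (T : AxisTable a c x l d u v p q s t) (hb : b = β • a + c + x) :
    b * a = β • a + d • x := by
  rw [hb, add_mul, add_mul, smul_mul_assoc, T.aa, T.ca, T.xa, add_zero]

theorem mul_comb [IsScalarTower F A A] [SMulCommClass F A A]
    (T : AxisTable a c x l d u v p q s t) (i j k i' j' k' : F) :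
    (i • a + j • c + k • x) * (i' • a + j' • c + k' • x) =
      (i * i' + j * j' * u + k * k' * s) • a + (j * j' * v + k * k' * t) • c +
        (i * k' * l + k * i' * d + j * k' * p + k * j' * q) • x := by
  simp only [add_mul, mul_add, smul_mul_assoc, mul_smul_comm, T.aa, T.ac, T.ca, T.ax, T.xa, T.cc,
    T.cx, T.xc, T.xx]
  module

/-- The three vectors are eigenvectors of left multiplication by `a` for the distinct eigenvalues 1,
0, `l`. The conclusion concerns multiples rather than coefficients because `a`, `c` or `x` may
vanish; this lets one table serve all dimensions. -/
theorem smul_eq_zero_of_eigen (T : AxisTable a c x l d u v p q s t)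
    [SMulCommClass F A A] (hl : l ≠ 0) (hl1 : l ≠ 1) {i j k : F}
    (h : i • a + j • c + k • x = 0) : i • a = 0 ∧ j • c = 0 ∧ k • x = 0 := by
  have h1 : i • a + (l * k) • x = 0 := by
    have := congrArg (a * ·) h
    simp only [mul_add, mul_smul_comm, T.aa, T.ac, T.ax, mul_zero, smul_zero, add_zero] at this
    rw [← this]; module
  have h2 : i • a + (l * l * k) • x = 0 := by
    have := congrArg (a * ·) h1
    simp only [mul_add, mul_smul_comm, T.aa, T.ax, mul_zero] at this
    rw [← this]; module
  have h3 : (l * (1 - l)) • (k • x) = 0 := by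
    rw [← sub_eq_zero.2 (h1.trans h2.symm)]; module
  have hk : k • x = 0 :=
    (smul_eq_zero.1 h3).resolve_left (mul_ne_zero hl (sub_ne_zero.2 (Ne.symm hl1)))
  have hi : i • a = 0 := by
    rw [mul_smul, hk, smul_zero, add_zero] at h1; exact h1
  refine ⟨hi, ?_, hk⟩
  rw [hi, hk, zero_add, add_zero] at h; exact h

theorem comb_inj (T : AxisTable a c x l d u v p q s t)
    [SMulCommClass F A A] (hl : l ≠ 0) (hl1 : l ≠ 1) {i j k i' j' k' : F}
    (h : i • a + j • c + k • x = i' • a + j' • c + k' • x) :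
    (a ≠ 0 → i = i') ∧ (c ≠ 0 → j = j') ∧ (x ≠ 0 → k = k') := by
  have h0 : (i - i') • a + (j - j') • c + (k - k') • x = 0 := by
    rw [← sub_eq_zero.2 h]; module
  obtain ⟨h1, h2, h3⟩ := T.smul_eq_zero_of_eigen hl hl1 h0
  exact ⟨fun ha => sub_eq_zero.1 ((smul_eq_zero.1 h1).resolve_right ha),
    fun ha => sub_eq_zero.1 ((smul_eq_zero.1 h2).resolve_right ha),
    fun ha => sub_eq_zero.1 ((smul_eq_zero.1 h3).resolve_right ha)⟩

/-- Serves both the left and the right eigenspace decomposition, since `a`, `c` are even and `x` is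
odd for each of them. -/
theorem isZ2Grading [IsScalarTower F A A] [SMulCommClass F A A]
    (T : AxisTable a c x l d u v p q s t) {P M : Submodule F A} (hd : Disjoint P M)
    (hP : ∀ z ∈ P, ∃ i j : F, z = i • a + j • c) (hM : ∀ z ∈ M, ∃ k : F, z = k • x)
    (haP : a ∈ P) (hcP : c ∈ P) (hxM : x ∈ M) : IsZ2Grading P M := by
  have P' (i j : F) : i • a + j • c ∈ P := P.add_mem (P.smul_mem _ haP) (P.smul_mem _ hcP)
  have M' (k : F) : k • x ∈ M := M.smul_mem _ hxM
  refine ⟨⟨hd, ?_⟩, ?_, ?_, ?_, ?_⟩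
  · rw [codisjoint_iff, Submodule.eq_top_iff']
    intro z
    obtain ⟨i, j, k, rfl⟩ := T.spans z
    exact Submodule.add_mem_sup (P' i j) (M' k)
  · intro z hz w hw
    obtain ⟨i, j, rfl⟩ := hP z hz
    obtain ⟨i', j', rfl⟩ := hP w hw
    convert P' (i * i' + j * j' * u) (j * j' * v) using 1
    simpa using T.mul_comb i j 0 i' j' 0
  · intro z hz w hw
    obtain ⟨i, j, rfl⟩ := hP z hz
    obtain ⟨k, rfl⟩ := hM w hw
    convert M' (i * k * l + j * k * p) using 1
    simpa using T.mul_comb i j 0 0 0 k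
  · intro z hz w hw
    obtain ⟨i, j, rfl⟩ := hP w hw
    obtain ⟨k, rfl⟩ := hM z hz
    convert M' (k * i * d + k * j * q) using 1
    simpa using T.mul_comb 0 0 k i j 0
  · intro z hz w hw
    obtain ⟨k, rfl⟩ := hM z hz
    obtain ⟨k', rfl⟩ := hM w hw
    convert P' (k * k' * s) (k * k' * t) using 1
    simpa using T.mul_comb 0 0 k 0 0 k'

theorem left_eigen [IsScalarTower F A A] [SMulCommClass F A A]
    (T : AxisTable a c x l d u v p q s t) (hl : l ≠ 0) (hl1 : l ≠ 1) {z : A} {μ : F}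
    (hz : z ∈ leftEigenspace a μ) : ∃ i j k : F, z = i • a + j • c + k • x ∧
      ((1 - μ) * i) • a = 0 ∧ (-μ * j) • c = 0 ∧ ((l - μ) * k) • x = 0 := by
  obtain ⟨i, j, k, rfl⟩ := T.spans z
  refine ⟨i, j, k, rfl, T.smul_eq_zero_of_eigen hl hl1 ?_⟩
  have h := mem_leftEigenspace.1 hz
  simp only [mul_add, mul_smul_comm, T.aa, T.ac, T.ax] at h
  rw [← sub_eq_zero.2 h]; module

theorem right_eigen [IsScalarTower F A A] [SMulCommClass F A A]
    (T : AxisTable a c x l d u v p q s t) (hl : l ≠ 0) (hl1 : l ≠ 1) {z : A} {μ : F}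
    (hz : z ∈ rightEigenspace a μ) : ∃ i j k : F, z = i • a + j • c + k • x ∧
      ((1 - μ) * i) • a = 0 ∧ (-μ * j) • c = 0 ∧ ((d - μ) * k) • x = 0 := by
  obtain ⟨i, j, k, rfl⟩ := T.spans z
  refine ⟨i, j, k, rfl, T.smul_eq_zero_of_eigen hl hl1 ?_⟩
  have h := mem_rightEigenspace.1 hz
  simp only [add_mul, smul_mul_assoc, T.aa, T.ca, T.xa] at h
  rw [← sub_eq_zero.2 h]; module

/-- The criterion by which every idempotent is recognised: in table coordinates the left and the
right eigenspaces are both the lines through `a`, `c` and `x`, so all axioms can be read off. -/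
theorem isPrimitiveAxisOfType [IsScalarTower F A A] [SMulCommClass F A A]
    (T : AxisTable a c x l d u v p q s t) (ha : a ≠ 0) (hl : l ≠ 0) (hl1 : l ≠ 1)
    (hd : d ≠ 0) (hd1 : d ≠ 1) : IsPrimitiveAxisOfType a l d := by
  have cancel {κ k : F} {z : A} (hκ : κ ≠ 0) (h : (κ * k) • z = 0) : k • z = 0 := by
    rw [mul_smul] at h; exact (smul_eq_zero.1 h).resolve_left hκ
  have sl1 : (1 : F) - l ≠ 0 := sub_ne_zero.2 hl1.symm
  have sl2 : l - 1 ≠ 0 := sub_ne_zero.2 hl1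
  have sd1 : (1 : F) - d ≠ 0 := sub_ne_zero.2 hd1.symm
  have sd2 : d - 1 ≠ 0 := sub_ne_zero.2 hd1
  have L1 {z : A} (hz : z ∈ leftEigenspace a (1 : F)) : ∃ i : F, z = i • a := by
    obtain ⟨i, j, k, rfl, h1, h2, h3⟩ := T.left_eigen hl hl1 hz
    exact ⟨i, by rw [cancel (by simp) h2, cancel sl2 h3]; simp⟩
  have L0 {z : A} (hz : z ∈ leftEigenspace a (0 : F)) : ∃ j : F, z = j • c := by
    obtain ⟨i, j, k, rfl, h1, h2, h3⟩ := T.left_eigen hl hl1 hz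
    exact ⟨j, by rw [cancel (by simp) h1, cancel (by simpa using hl) h3]; simp⟩
  have Ll {z : A} (hz : z ∈ leftEigenspace a l) : ∃ k : F, z = k • x := by
    obtain ⟨i, j, k, rfl, h1, h2, h3⟩ := T.left_eigen hl hl1 hz
    exact ⟨k, by rw [cancel sl1 h1, cancel (by simpa using hl) h2]; simp⟩
  have R1 {z : A} (hz : z ∈ rightEigenspace a (1 : F)) : ∃ i : F, z = i • a := by
    obtain ⟨i, j, k, rfl, h1, h2, h3⟩ := T.right_eigen hl hl1 hz
    exact ⟨i, by rw [cancel (by simp) h2, cancel sd2 h3]; simp⟩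
  have R0 {z : A} (hz : z ∈ rightEigenspace a (0 : F)) : ∃ j : F, z = j • c := by
    obtain ⟨i, j, k, rfl, h1, h2, h3⟩ := T.right_eigen hl hl1 hz
    exact ⟨j, by rw [cancel (by simp) h1, cancel (by simpa using hd) h3]; simp⟩
  have Rd {z : A} (hz : z ∈ rightEigenspace a d) : ∃ k : F, z = k • x := by
    obtain ⟨i, j, k, rfl, h1, h2, h3⟩ := T.right_eigen hl hl1 hz
    exact ⟨k, by rw [cancel sd1 h1, cancel (by simpa using hd) h2]; simp⟩
  have aL : a ∈ leftEigenspace a (1 : F) := mem_leftEigenspace.2 (by simp [T.aa])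
  have aR : a ∈ rightEigenspace a (1 : F) := mem_rightEigenspace.2 (by simp [T.aa])
  have cL : c ∈ leftEigenspace a (0 : F) := mem_leftEigenspace.2 (by simp [T.ac])
  have cR : c ∈ rightEigenspace a (0 : F) := mem_rightEigenspace.2 (by simp [T.ca])
  have indep {j k : F} (h : j • c = k • x) : j • c = 0 :=
    (T.smul_eq_zero_of_eigen hl hl1 (i := 0) (j := j) (k := -k) (by rw [h]; module)).2.1
  refine ⟨⟨ha, T.aa, hl, hl1, ?_⟩, ⟨ha, T.aa, hd, hd1, ?_⟩, ?_, ?_, ?_, ?_, ?_⟩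
  · have hP : ∀ z ∈ leftEigenspace a (1 : F) ⊔ leftEigenspace a (0 : F),
        ∃ i j : F, z = i • a + j • c := by
      intro z hz
      obtain ⟨y, hy, w, hw, rfl⟩ := Submodule.mem_sup.1 hz
      obtain ⟨i, rfl⟩ := L1 hy
      obtain ⟨j, rfl⟩ := L0 hw
      exact ⟨i, j, rfl⟩
    refine T.isZ2Grading ?_ hP (fun z => Ll) (Submodule.mem_sup_left aL)
      (Submodule.mem_sup_right cL) (mem_leftEigenspace.2 T.ax)
    rw [Submodule.disjoint_def]
    intro z hz hz'
    obtain ⟨i, j, rfl⟩ := hP z hz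
    obtain ⟨k, hk⟩ := Ll hz'
    have := T.smul_eq_zero_of_eigen hl hl1 (i := i) (j := j) (k := -k) (by rw [hk]; module)
    rw [this.1, this.2.1, add_zero]
  · have hP : ∀ z ∈ rightEigenspace a (1 : F) ⊔ rightEigenspace a (0 : F),
        ∃ i j : F, z = i • a + j • c := by
      intro z hz
      obtain ⟨y, hy, w, hw, rfl⟩ := Submodule.mem_sup.1 hz
      obtain ⟨i, rfl⟩ := R1 hy
      obtain ⟨j, rfl⟩ := R0 hw
      exact ⟨i, j, rfl⟩
    refine T.isZ2Grading ?_ hP (fun z => Rd) (Submodule.mem_sup_left aR)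
      (Submodule.mem_sup_right cR) (mem_rightEigenspace.2 T.xa)
    rw [Submodule.disjoint_def]
    intro z hz hz'
    obtain ⟨i, j, rfl⟩ := hP z hz
    obtain ⟨k, hk⟩ := Rd hz'
    have := T.smul_eq_zero_of_eigen hl hl1 (i := i) (j := j) (k := -k) (by rw [hk]; module)
    rw [this.1, this.2.1, add_zero]
  · intro y
    obtain ⟨i, j, k, rfl⟩ := T.spans y
    simp only [add_mul, mul_add, smul_mul_assoc, mul_smul_comm, T.aa, T.ac, T.ca, T.ax, T.xa,
      mul_zero, zero_mul, smul_zero]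
    module
  · refine le_antisymm (fun z hz => ?_) (by simpa using aL)
    obtain ⟨i, rfl⟩ := L1 hz
    exact Submodule.mem_span_singleton.2 ⟨i, rfl⟩
  · refine le_antisymm (fun z hz => ?_) (by simpa using aR)
    obtain ⟨i, rfl⟩ := R1 hz
    exact Submodule.mem_span_singleton.2 ⟨i, rfl⟩
  · rw [Submodule.eq_bot_iff]
    rintro z ⟨hz, hz'⟩
    obtain ⟨k, hk⟩ := Ll hz
    obtain ⟨j, rfl⟩ := R0 hz'
    exact indep hk
  · rw [Submodule.eq_bot_iff]
    rintro z ⟨hz, hz'⟩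
    obtain ⟨j, rfl⟩ := L0 hz
    obtain ⟨k, hk⟩ := Rd hz'
    exact indep hk

end AxisTable

/-! ### Joint eigenvectors of a primitive axis -/

namespace IsPrimitiveAxisOfType

variable [IsScalarTower F A A] [SMulCommClass F A A] {a : A} {l d : F}

theorem mem_even (h : IsPrimitiveAxisOfType a l d) {z : A} :
    z ∈ leftEigenspace a (1 : F) ⊔ leftEigenspace a (0 : F) ↔
      ∃ i : F, ∃ c : A, a * c = 0 ∧ z = i • a + c := by
  rw [Submodule.mem_sup, h.left_primitive]
  constructor
  · rintro ⟨y, hy, c, hc, rfl⟩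
    obtain ⟨i, rfl⟩ := Submodule.mem_span_singleton.1 hy
    exact ⟨i, c, by simpa using mem_leftEigenspace.1 hc, rfl⟩
  · rintro ⟨i, c, hc, rfl⟩
    exact ⟨_, Submodule.mem_span_singleton.2 ⟨i, rfl⟩, c, mem_leftEigenspace.2 (by simp [hc]), rfl⟩

theorem exists_left_decomp (h : IsPrimitiveAxisOfType a l d) (z : A) :
    ∃ (i : F) (c x : A), z = i • a + c + x ∧ a * c = 0 ∧ a * x = l • x := by
  have hz : z ∈ (leftEigenspace a (1 : F) ⊔ leftEigenspace a (0 : F)) ⊔ leftEigenspace a l := by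
    rw [h.left.grading.isCompl.sup_eq_top]; trivial
  obtain ⟨y, hy, x, hx, rfl⟩ := Submodule.mem_sup.1 hz
  obtain ⟨i, c, hc, rfl⟩ := h.mem_even.1 hy
  exact ⟨i, c, x, rfl, hc, mem_leftEigenspace.1 hx⟩

theorem exists_right_decomp (h : IsPrimitiveAxisOfType a l d) (z : A) :
    ∃ (i : F) (c x : A), z = i • a + c + x ∧ c * a = 0 ∧ x * a = d • x := by
  have hz : z ∈ (rightEigenspace a (1 : F) ⊔ rightEigenspace a (0 : F)) ⊔ rightEigenspace a d := by
    rw [h.right.grading.isCompl.sup_eq_top]; trivial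
  obtain ⟨e, he, x, hx, rfl⟩ := Submodule.mem_sup.1 hz
  obtain ⟨y, hy, c, hc, rfl⟩ := Submodule.mem_sup.1 he
  rw [h.right_primitive] at hy
  obtain ⟨i, rfl⟩ := Submodule.mem_span_singleton.1 hy
  have hc' := mem_rightEigenspace.1 hc
  rw [zero_smul] at hc'
  exact ⟨i, c, x, rfl, hc', mem_rightEigenspace.1 hx⟩

theorem right_components_zero (h : IsPrimitiveAxisOfType a l d) {i : F} {c x : A}
    (hc : c * a = 0) (hx : x * a = d • x) (h0 : i • a + c + x = 0) : i = 0 ∧ c = 0 ∧ x = 0 := by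
  have h1 : i • a + d • x = 0 := by
    have := congrArg (· * a) h0
    simpa only [add_mul, smul_mul_assoc, h.left.idem, hc, hx, add_zero, zero_mul] using this
  have h2 : i • a + (d * d) • x = 0 := by
    have := congrArg (· * a) h1
    simpa only [add_mul, smul_mul_assoc, h.left.idem, hx, zero_mul, smul_smul] using this
  have h3 : (d * (1 - d)) • x = 0 := by
    rw [← sub_eq_zero.2 (h1.trans h2.symm)]; module
  have hx0 : x = 0 := (smul_eq_zero.1 h3).resolve_left
    (mul_ne_zero h.right.del_ne_zero (sub_ne_zero.2 h.right.del_ne_one.symm))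
  subst hx0
  rw [smul_zero, add_zero] at h1
  refine ⟨(smul_eq_zero.1 h1).resolve_right h.left.ne_zero, ?_, rfl⟩
  rw [h1, zero_add, add_zero] at h0; exact h0

/-- Left and right multiplication by `a` commute, so left multiplication kills each right component
of `c` separately. The component along `a` then vanishes, and the `d`-component lies in a mixed
joint eigenspace, which is zero. -/
theorem mul_right_eq_zero (h : IsPrimitiveAxisOfType a l d) {c : A} (hc : a * c = 0) :
    c * a = 0 := by
  obtain ⟨i, c₀, c₁, rfl, h0, h1⟩ := h.exists_right_decomp c
  have h2 : (a * c₀) * a = 0 := by rw [← h.comm, h0, mul_zero]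
  have h3 : (a * c₁) * a = d • (a * c₁) := by rw [← h.comm, h1, mul_smul_comm]
  rw [mul_add, mul_add, mul_smul_comm, h.left.idem] at hc
  obtain ⟨rfl, -, hc1⟩ := h.right_components_zero h2 h3 hc
  have hm : c₁ ∈ leftEigenspace a (0 : F) ⊓ rightEigenspace a d :=
    ⟨mem_leftEigenspace.2 (by simp [hc1]), mem_rightEigenspace.2 h1⟩
  rw [h.zero_del] at hm
  rw [(Submodule.mem_bot F).1 hm]; simpa using h0

/-- Same argument, with `L_a - l` in place of `L_a` and the other mixed eigenspace. -/
theorem mul_right_eq_smul (h : IsPrimitiveAxisOfType a l d) {x : A} (hx : a * x = l • x) :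
    x * a = d • x := by
  obtain ⟨i, c₀, c₁, rfl, h0, h1⟩ := h.exists_right_decomp x
  have h2 : (a * c₀ - l • c₀) * a = 0 := by
    rw [sub_mul, ← h.comm, smul_mul_assoc, h0, mul_zero, smul_zero, sub_zero]
  have h3 : (a * c₁ - l • c₁) * a = d • (a * c₁ - l • c₁) := by
    rw [sub_mul, ← h.comm, smul_mul_assoc, h1, mul_smul_comm]; module
  rw [mul_add, mul_add, mul_smul_comm, h.left.idem] at hx
  have hx' : (i * (1 - l)) • a + (a * c₀ - l • c₀) + (a * c₁ - l • c₁) = 0 := by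
    rw [← sub_eq_zero.2 hx]; module
  obtain ⟨hi, hc0, -⟩ := h.right_components_zero h2 h3 hx'
  have hi0 : i = 0 := (mul_eq_zero.1 hi).resolve_right (sub_ne_zero.2 h.left.lam_ne_one.symm)
  have hm : c₀ ∈ leftEigenspace a l ⊓ rightEigenspace a (0 : F) :=
    ⟨mem_leftEigenspace.2 (sub_eq_zero.1 hc0), mem_rightEigenspace.2 (by simp [h0])⟩
  rw [h.lam_zero] at hm
  rw [(Submodule.mem_bot F).1 hm, hi0]; simpa using h1

theorem components_eq (h : IsPrimitiveAxisOfType a l d) {z w i k : A}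
    (hz : z ∈ leftEigenspace a (1 : F) ⊔ leftEigenspace a (0 : F)) (hw : w ∈ leftEigenspace a l)
    (hi : i ∈ leftEigenspace a (1 : F) ⊔ leftEigenspace a (0 : F)) (hk : k ∈ leftEigenspace a l)
    (he : z + w = i + k) : z = i ∧ w = k := by
  have h1 : z - i = k - w := by
    rw [sub_eq_sub_iff_add_eq_add, he, add_comm]
  have h2 := Submodule.disjoint_def.1 h.left.grading.isCompl.disjoint (z - i)
    (Submodule.sub_mem _ hz hi) (h1 ▸ Submodule.sub_mem _ hk hw)
  rw [h2] at h1
  exact ⟨sub_eq_zero.1 h2, (sub_eq_zero.1 h1.symm).symm⟩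

end IsPrimitiveAxisOfType

end AxisTables

/-! ### Two primitive axes span an algebra of dimension at most three -/

section TwoGenerated

variable {F A : Type*} [Field F] [NonUnitalNonAssocRing A] [Module F A]

theorem Submodule.mem_span_triple_iff {a c x z : A} :
    z ∈ Submodule.span F {a, c, x} ↔ ∃ i j k : F, z = i • a + j • c + k • x := by
  rw [Submodule.mem_span_triple]
  simp only [eq_comm]

variable [IsScalarTower F A A] [SMulCommClass F A A] {a b : A} {l d m n : F}

/-- The components are recovered from `a`, `b` and `a * b`, because `a * b = β • a + l • x` with `l`
invertible. -/
theorem IsPrimitiveAxisOfType.span_components_le (ha : IsPrimitiveAxisOfType a l d)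
    {β : F} {c x : A} (hb : b = β • a + c + x) (hc : a * c = 0) (hx : a * x = l • x)
    {W : Submodule F A} (haW : a ∈ W) (hbW : b ∈ W) (habW : a * b ∈ W) :
    Submodule.span F {a, c, x} ≤ W := by
  have hxW : x ∈ W := by
    have : x = l⁻¹ • (a * b - β • a) := by
      rw [hb, mul_add, mul_add, mul_smul_comm, ha.left.idem, hc, hx, add_zero, add_sub_cancel_left,
        inv_smul_smul₀ ha.left.lam_ne_zero]
    rw [this]
    exact W.smul_mem _ (W.sub_mem habW (W.smul_mem _ haW))
  have hcW : c ∈ W := by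
    have : c = b - β • a - x := by rw [hb]; abel
    rw [this]
    exact W.sub_mem (W.sub_mem hbW (W.smul_mem _ haW)) hxW
  rw [Submodule.span_le]
  rintro z (rfl | rfl | rfl) <;> assumption

/-- The structure of an algebra generated by two primitive axes. -/
theorem IsPrimitiveAxisOfType.exists_axisTable (ha : IsPrimitiveAxisOfType a l d)
    (hb : IsPrimitiveAxisOfType b m n) (hgen : NonUnitalAlgebra.adjoin F ({a, b} : Set A) = ⊤) :
    ∃ (β : F) (c x : A) (u v p q s t : F),
      AxisTable a c x l d u v p q s t ∧ b = β • a + c + x := by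
  obtain ⟨β, c, x, hbe, hac, hax⟩ := ha.exists_left_decomp b
  obtain ⟨α, c', y, hae, hbc, hby⟩ := hb.exists_left_decomp a
  have hca := ha.mul_right_eq_zero hac
  have hxa := ha.mul_right_eq_smul hax
  have hcb := hb.mul_right_eq_zero hbc
  have hyb := hb.mul_right_eq_smul hby
  set V := Submodule.span F {a, c, x} with hV
  have aV : a ∈ V := Submodule.subset_span (by simp)
  have cV : c ∈ V := Submodule.subset_span (by simp)
  have xV : x ∈ V := Submodule.subset_span (by simp)
  have bV : b ∈ V := hbe ▸ V.add_mem (V.add_mem (V.smul_mem _ aV) cV) xV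
  have baV : b * a ∈ V := by
    have : b * a = β • a + d • x := by
      rw [hbe, add_mul, add_mul, smul_mul_assoc, ha.left.idem, hca, hxa, add_zero]
    rw [this]; exact V.add_mem (V.smul_mem _ aV) (V.smul_mem _ xV)
  have hVW : V = Submodule.span F {b, c', y} := by
    apply le_antisymm
    · have bW : b ∈ Submodule.span F {b, c', y} := Submodule.subset_span (by simp)
      have cW : c' ∈ Submodule.span F {b, c', y} := Submodule.subset_span (by simp)
      have yW : y ∈ Submodule.span F {b, c', y} := Submodule.subset_span (by simp)
      refine ha.span_components_le hbe hac hax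
        (Submodule.mem_span_triple_iff.2 ⟨α, 1, 1, by simpa using hae⟩) bW ?_
      have : a * b = α • b + n • y := by
        conv_lhs => rw [hae]
        rw [add_mul, add_mul, smul_mul_assoc, hb.left.idem, hcb, hyb, add_zero]
      rw [this]
      exact Submodule.add_mem _ (Submodule.smul_mem _ _ bW) (Submodule.smul_mem _ _ yW)
    · exact hb.span_components_le hae hbc hby bV aV baV
  -- `V` is spanned by eigenvectors of left multiplication by `b`.
  have stab {z : A} (hz : z ∈ V) : b * z ∈ V := by
    rw [hVW] at hz ⊢
    obtain ⟨i, j, k, rfl⟩ := Submodule.mem_span_triple_iff.1 hz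
    refine Submodule.mem_span_triple_iff.2 ⟨i, 0, k * m, ?_⟩
    rw [mul_add, mul_add, mul_smul_comm, mul_smul_comm, mul_smul_comm, hb.left.idem, hbc, hby]
    module
  have memE (i j : F) : i • a + j • c ∈ leftEigenspace a (1 : F) ⊔ leftEigenspace a (0 : F) :=
    ha.mem_even.2 ⟨i, j • c, by rw [mul_smul_comm, hac, smul_zero], rfl⟩
  have cE : c ∈ leftEigenspace a (1 : F) ⊔ leftEigenspace a (0 : F) := by simpa using memE 0 1
  have xO : x ∈ leftEigenspace a l := mem_leftEigenspace.2 hax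
  have gr := ha.left.grading
  obtain ⟨u, v, q, h1⟩ := Submodule.mem_span_triple_iff.1 (stab cV)
  -- Since `a * c = 0`, the product `b * c` is `c * c` (even) plus `x * c` (odd), and both parts can
  -- be compared separately.
  have h1' : c * c + x * c = (u • a + v • c) + q • x := by
    rw [← h1, hbe, add_mul, add_mul, smul_mul_assoc, hac, smul_zero, zero_add]
  obtain ⟨hcc, hxc⟩ := ha.components_eq (gr.even_even _ cE _ cE) (gr.odd_even _ xO _ cE)
    (memE u v) (Submodule.smul_mem _ q xO) h1'
  obtain ⟨s, t, p, h2⟩ := Submodule.mem_span_triple_iff.1 (stab xV)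
  -- Here `b * x` has the further odd term `β • (a * x) = (β * l) • x`, which is moved to the right.
  have h2' : x * x + c * x = (s • a + t • c) + (p - β * l) • x := by
    have : b * x = β • l • x + c * x + x * x := by
      conv_lhs => rw [hbe]
      rw [add_mul, add_mul, smul_mul_assoc, hax]
    rw [this] at h2
    have h3 : x * x + c * x = (β • l • x + c * x + x * x) - (β * l) • x := by module
    rw [h3, h2]; module
  obtain ⟨hxx, hcx⟩ := ha.components_eq (gr.odd_odd _ xO _ xO) (gr.even_odd _ cE _ xO)
    (memE s t) (Submodule.smul_mem _ _ xO) h2'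
  have mul_mem {z w : A} (hz : z ∈ V) (hw : w ∈ V) : z * w ∈ V := by
    obtain ⟨i, j, k, rfl⟩ := Submodule.mem_span_triple_iff.1 hz
    obtain ⟨i', j', k', rfl⟩ := Submodule.mem_span_triple_iff.1 hw
    simp only [add_mul, mul_add, smul_mul_assoc, mul_smul_comm, ha.left.idem, hac, hca, hax, hxa,
      hcc, hcx, hxc, hxx]
    refine Submodule.mem_span_triple_iff.2 ⟨i * i' + j * j' * u + k * k' * s,
      j * j' * v + k * k' * t,
      i * k' * l + k * i' * d + j * k' * (p - β * l) + k * j' * q, ?_⟩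
    module
  let S : NonUnitalSubalgebra F A := { V with mul_mem' := mul_mem }
  have hS : NonUnitalAlgebra.adjoin F ({a, b} : Set A) ≤ S := by
    rw [NonUnitalAlgebra.adjoin_le_iff]
    rintro z (rfl | rfl)
    · exact aV
    · exact bV
  refine ⟨β, c, x, u, v, p - β * l, q, s, t, ⟨ha.left.idem, hac, hca, hax, hxa, hcc, hcx, hxc, hxx,
    fun z => ?_⟩, hbe⟩
  have hz : z ∈ S := hS (by rw [hgen]; trivial)
  exact Submodule.mem_span_triple_iff.1 hz

end TwoGenerated

/-! ### Idempotents of the individual algebras -/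

section Idempotents

variable {F A : Type*} [Field F] [NonUnitalNonAssocRing A] [Module F A]
  [IsScalarTower F A A] [SMulCommClass F A A] {a c x e : A} {l d u v p q s t : F}

namespace AxisTable

theorem isPrimitiveAxis (T : AxisTable a c x l d u v p q s t) (ha : a ≠ 0) (hl : l ≠ 0)
    (hl1 : l ≠ 1) (hd : d ≠ 0) (hd1 : d ≠ 1) : IsPrimitiveAxis F a :=
  ⟨l, d, T.isPrimitiveAxisOfType ha hl hl1 hd hd1⟩

theorem coord_of_idem (T : AxisTable a c x l d u v p q s t) (hl : l ≠ 0) (hl1 : l ≠ 1)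
    {i j k : F} (he : (i • a + j • c + k • x) * (i • a + j • c + k • x) =
      i • a + j • c + k • x) :
    (a ≠ 0 → i * i + j * j * u + k * k * s = i) ∧ (c ≠ 0 → j * j * v + k * k * t = j) ∧
      (x ≠ 0 → i * k * l + k * i * d + j * k * p + k * j * q = k) := by
  rw [T.mul_comb] at he
  exact T.comb_inj hl hl1 he

/-- Normalises `c` to an idempotent. -/
theorem rescale (T : AxisTable a c x l d 0 v p q s t) (hv : v ≠ 0) :
    AxisTable a (v⁻¹ • c) x l d 0 1 (v⁻¹ * p) (v⁻¹ * q) s (v * t) where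
  aa := T.aa
  ac := by rw [mul_smul_comm, T.ac, smul_zero]
  ca := by rw [smul_mul_assoc, T.ca, smul_zero]
  ax := T.ax
  xa := T.xa
  cc := by
    rw [mul_smul_comm, smul_mul_assoc, T.cc]
    match_scalars <;> field_simp
    simp
  cx := by rw [smul_mul_assoc, T.cx, smul_smul]
  xc := by rw [mul_smul_comm, T.xc, smul_smul]
  xx := by
    rw [T.xx]
    match_scalars <;> field_simp
  spans z := by
    obtain ⟨i, j, k, rfl⟩ := T.spans z
    exact ⟨i, v * j, k, by match_scalars <;> field_simp⟩

theorem add_isIdentity (T : AxisTable a c x l d 0 1 (1 - l) (1 - d) s t) (z : A) :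
    (a + c) * z = z ∧ z * (a + c) = z := by
  obtain ⟨i, j, k, rfl⟩ := T.spans z
  have h : a + c = (1 : F) • a + (1 : F) • c + (0 : F) • x := by module
  rw [h, T.mul_comb, T.mul_comb]
  constructor <;> module

/-- The algebra with left and right unit-complementary eigenvalues and `x * x = 0`. -/
theorem isPrimitiveAxis_of_xx_zero (T : AxisTable a c x l (1 - l) 0 1 (1 - l) l 0 0)
    (hl : l ≠ 0) (hl1 : l ≠ 1) (ha : a ≠ 0) (hc : c ≠ 0) (hx : x ≠ 0)
    (he : e * e = e) (he_zero : e ≠ 0) (he_one : ¬ ∀ z : A, e * z = z ∧ z * e = z) :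
    IsPrimitiveAxis F e := by
  -- The idempotents are `a + k x` and `c + k x`; exchanging `a` and `c` reduces the second family
  -- to the first.
  have key {a c : A} {l : F} (T : AxisTable a c x l (1 - l) 0 1 (1 - l) l 0 0)
      (hl : l ≠ 0) (hl1 : l ≠ 1) (k : F) (h0 : (1 : F) • a + (0 : F) • c + k • x ≠ 0) :
      IsPrimitiveAxis F ((1 : F) • a + (0 : F) • c + k • x) := by
    have T' : AxisTable ((1 : F) • a + (0 : F) • c + k • x)
        ((0 : F) • a + (1 : F) • c + (-k) • x) ((0 : F) • a + (0 : F) • c + (1 : F) • x)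
        l (1 - l) 0 1 (1 - l) l 0 0 := by
      refine ⟨?_, ?_, ?_, ?_, ?_, ?_, ?_, ?_, ?_, fun z => ?_⟩
      iterate 9
        rw [T.mul_comb]
        module
      obtain ⟨z₁, z₂, z₃, rfl⟩ := T.spans z
      exact ⟨z₁, z₂, z₃ + k * z₂ - k * z₁, by module⟩
    exact T'.isPrimitiveAxis h0 hl hl1 (sub_ne_zero.2 hl1.symm) (by simpa using hl)
  obtain ⟨i, j, k, rfl⟩ := T.spans e
  obtain ⟨h1, h2, h3⟩ := T.coord_of_idem hl hl1 he
  replace h1 := h1 ha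
  replace h2 := h2 hc
  replace h3 := h3 hx
  have hi : i = 0 ∨ i = 1 := by grind
  have hj : j = 0 ∨ j = 1 := by grind
  rcases hi with rfl | rfl <;> rcases hj with rfl | rfl
  · obtain rfl : k = 0 := by linear_combination -h3
    simp at he_zero
  · have T' : AxisTable c a x (1 - l) (1 - (1 - l)) 0 1 (1 - (1 - l)) (1 - l) 0 0 := by
      simpa using T.swap
    rw [show (0 : F) • a + (1 : F) • c + k • x = (1 : F) • c + (0 : F) • a + k • x by module]
      at he_zero ⊢
    exact key T' (sub_ne_zero.2 hl1.symm) (by simpa using hl) k he_zero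
  · exact key T hl hl1 k he_zero
  · obtain rfl : k = 0 := by linear_combination h3
    have T' : AxisTable a c x l (1 - l) 0 1 (1 - l) (1 - (1 - l)) 0 0 := by simpa using T
    exact absurd (by simpa using T'.add_isIdentity) he_one

/-- The three-dimensional Jordan algebras of a symmetric bilinear form. -/
theorem isPrimitiveAxis_of_jordan (T : AxisTable a c x l l 0 1 l l s s) (hl : 2 * l = 1)
    (ha : a ≠ 0) (hc : c ≠ 0) (hx : x ≠ 0)
    (he : e * e = e) (he_zero : e ≠ 0) (he_one : ¬ ∀ z : A, e * z = z ∧ z * e = z) :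
    IsPrimitiveAxis F e := by
  have hl0 : l ≠ 0 := by rintro rfl; simp at hl
  have hl1 : l ≠ 1 := by rintro rfl; exact one_ne_zero (by linear_combination hl : (1 : F) = 0)
  obtain ⟨i, j, k, rfl⟩ := T.spans e
  obtain ⟨h1, h2, h3⟩ := T.coord_of_idem hl0 hl1 he
  replace h1 := h1 ha
  replace h2 := h2 hc
  replace h3 := h3 hx
  have hij : i + j = 1 := by
    have h3' : k * (i + j - 1) = 0 := by linear_combination h3 - k * (i + j) * hl
    rcases mul_eq_zero.1 h3' with rfl | h
    · have hi : i = 0 ∨ i = 1 := by grind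
      have hj : j = 0 ∨ j = 1 := by grind
      rcases hi with rfl | rfl <;> rcases hj with rfl | rfl
      · simp at he_zero
      · simp
      · simp
      · have T' : AxisTable a c x l l 0 1 (1 - l) (1 - l) s s := by
          rwa [show 1 - l = l by linear_combination -hl]
        exact absurd (by simpa using T'.add_isIdentity) he_one
    · linear_combination h
  obtain rfl : j = 1 - i := by linear_combination hij
  -- With `1 = a + c`, write `e = (1 + f) / 2`, where `f = (2i - 1)(a - c) + 2k x` squares to 1. The
  -- complement is `1 - e`, and the odd vector is the vector orthogonal to `f` in the plane of `a -
  -- c` and `x`, with the same square as `x`.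
  have T' : AxisTable (i • a + (1 - i) • c + k • x) ((1 - i) • a + i • c + (-k) • x)
      ((-2 * k * s) • a + (2 * k * s) • c + (2 * i - 1) • x) l l 0 1 l l s s := by
    refine ⟨?_, ?_, ?_, ?_, ?_, ?_, ?_, ?_, ?_, fun z => ?_⟩
    iterate 9
      rw [T.mul_comb]
      match_scalars <;> grind
    obtain ⟨z₁, z₂, z₃, rfl⟩ := T.spans z
    refine ⟨(z₁ + z₂) * l + (z₁ - z₂) * l * (2 * i - 1) + z₃ * (2 * k * s),
      (z₁ + z₂) * l - (z₁ - z₂) * l * (2 * i - 1) - z₃ * (2 * k * s),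
      -(z₁ - z₂) * k + z₃ * (2 * i - 1), ?_⟩
    match_scalars <;> grind
  exact T'.isPrimitiveAxis he_zero hl0 hl1 hl0 hl1

/-- The nonunital three-dimensional Jordan algebra. -/
theorem isPrimitiveAxis_of_jordan_nonunital (T : AxisTable a c x l l 0 0 0 0 0 1)
    (hl : 2 * l = 1) (ha : a ≠ 0) (hc : c ≠ 0) (hx : x ≠ 0) (he : e * e = e) (he_zero : e ≠ 0) :
    IsPrimitiveAxis F e := by
  have hl0 : l ≠ 0 := by rintro rfl; simp at hl
  have hl1 : l ≠ 1 := by rintro rfl; exact one_ne_zero (by linear_combination hl : (1 : F) = 0)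
  obtain ⟨i, j, k, rfl⟩ := T.spans e
  obtain ⟨h1, h2, h3⟩ := T.coord_of_idem hl0 hl1 he
  replace h1 := h1 ha
  replace h2 := h2 hc
  replace h3 := h3 hx
  obtain rfl : j = k * k := by linear_combination -h2
  have hi : i = 1 := by
    by_contra hi
    have hi0 : i = 0 := by grind
    subst hi0
    obtain rfl : k = 0 := by linear_combination -h3
    simp at he_zero
  subst hi
  -- The nonzero idempotents form the curve `a + k² c + k x`; the odd vector is its tangent `2k c +
  -- x`.
  have T' : AxisTable ((1 : F) • a + (k * k) • c + k • x) ((0 : F) • a + (1 : F) • c + (0 : F) • x)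
      ((0 : F) • a + (2 * k) • c + (1 : F) • x) l l 0 0 0 0 0 1 := by
    refine ⟨?_, ?_, ?_, ?_, ?_, ?_, ?_, ?_, ?_, fun z => ?_⟩
    iterate 9
      rw [T.mul_comb]
      match_scalars <;> grind
    obtain ⟨z₁, z₂, z₃, rfl⟩ := T.spans z
    exact ⟨z₁, z₂ + k * k * z₁ - 2 * k * z₃, z₃ - k * z₁, by module⟩
  exact T'.isPrimitiveAxis he_zero hl0 hl1 hl0 hl1

/-- The unital hull of the algebras of type `3C(l)`. -/
theorem isPrimitiveAxis_of_matsuo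
    (T : AxisTable a c x l l 0 1 (1 - l) (1 - l) s t) (hs : 4 * s = l * (2 - l))
    (ht : 4 * t = 1 - l * l) (h2 : (2 : F) ≠ 0) (hlh : 2 * l ≠ 1) (hl : l ≠ 0) (hl1 : l ≠ 1)
    (ha : a ≠ 0) (hc : c ≠ 0) (hx : x ≠ 0)
    (he : e * e = e) (he_zero : e ≠ 0) (he_one : ¬ ∀ z : A, e * z = z ∧ z * e = z) :
    IsPrimitiveAxis F e := by
  -- Besides `a`, the axes of type `l` are the two vectors with these coordinates, mirror images
  -- under `x ↦ -x`. The other nontrivial idempotents are complements `1 - e`, of type `1 - l`,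
  -- reached by exchanging `a` and `c`.
  have key {a c : A} {l s t : F} (T : AxisTable a c x l l 0 1 (1 - l) (1 - l) s t)
      (hs : 4 * s = l * (2 - l)) (ht : 4 * t = 1 - l * l) (hl : l ≠ 0) (hl1 : l ≠ 1) {i j k : F}
      (hi : 2 * i = l) (hj : 2 * j = 1 + l) (hk : k * k = 1)
      (h0 : i • a + j • c + k • x ≠ 0) :
      IsPrimitiveAxis F (i • a + j • c + k • x) := by
    have T' : AxisTable (i • a + j • c + k • x) ((1 - i) • a + (1 - j) • c + (-k) • x)
        ((1 - i) • a + (-j) • c + k • x) l l 0 1 (1 - l) (1 - l) (4 * s) (4 * t) := by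
      refine ⟨?_, ?_, ?_, ?_, ?_, ?_, ?_, ?_, ?_, fun z => ?_⟩
      iterate 9
        rw [T.mul_comb]
        match_scalars <;> grind
      obtain ⟨z₁, z₂, z₃, rfl⟩ := T.spans z
      refine ⟨z₁ * (l / 2) + z₂ * ((2 - l) / 2) + z₃ * k * ((2 - l) / 4),
        z₁ * ((1 + l) / 2) + z₂ * ((1 - l) / 2) - z₃ * k * ((1 + l) / 4),
        z₁ / 2 - z₂ / 2 + z₃ * k / 4, ?_⟩
      match_scalars <;> grind
    exact T'.isPrimitiveAxis h0 hl hl1 hl hl1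
  have m0 : 1 - l ≠ 0 := sub_ne_zero.2 hl1.symm
  have m1 : 1 - l ≠ 1 := by simpa using hl
  have Tsw : AxisTable c a x (1 - l) (1 - l) 0 1 (1 - (1 - l)) (1 - (1 - l)) t s := by
    simpa using T.swap
  obtain ⟨i, j, k, rfl⟩ := T.spans e
  obtain ⟨e1, e2, e3⟩ := T.coord_of_idem hl hl1 he
  replace e1 := e1 ha
  replace e2 := e2 hc
  replace e3 := e3 hx
  by_cases hk : k = 0
  · subst hk
    have hi : i = 0 ∨ i = 1 := by grind
    have hj : j = 0 ∨ j = 1 := by grind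
    rcases hi with rfl | rfl <;> rcases hj with rfl | rfl
    · simp at he_zero
    · simpa using Tsw.isPrimitiveAxis hc m0 m1 m0 m1
    · simpa using T.isPrimitiveAxis ha hl hl1 hl hl1
    · exact absurd (by simpa using T.add_isIdentity) he_one
  · have e3' : 2 * i * l + 2 * j * (1 - l) = 1 :=
      mul_left_cancel₀ hk (by linear_combination e3)
    -- `r` parametrises the line `e3'`; the two remaining equations become linear in `r²` and `k²`,
    -- and `2 * l ≠ 1` makes `r² = k² = 1` their only solution.
    obtain ⟨r, hr⟩ : ∃ r, 2 * i = 1 + r * (1 - l) := ⟨(2 * i - 1) / (1 - l), by field_simp; ring⟩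
    have hj : 2 * j = 1 - r * l := by
      apply mul_left_cancel₀ m0
      linear_combination e3' - l * hr
    have f1 : 1 - r * r * (1 - l) * (1 - l) = k * k * (l * (2 - l)) := by
      rw [← hs]
      linear_combination (2 * i - 1 + r * (1 - l)) * hr - 4 * e1
    have f2 : 1 - r * r * l * l = k * k * (1 - l * l) := by
      rw [← ht]
      linear_combination (2 * j - 1 - r * l) * hj - 4 * e2
    have hr2 : r * r = 1 := by
      have h : (2 * l - 1) * (r * r - 1) = 0 := by
        linear_combination (1 - l * l) * f1 - l * (2 - l) * f2
      exact sub_eq_zero.1 ((mul_eq_zero.1 h).resolve_left (sub_ne_zero.2 hlh))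
    have hk2 : k * k = 1 := by
      have g1 : l * (2 - l) * (k * k - 1) = 0 := by
        linear_combination -f1 - (1 - l) * (1 - l) * hr2
      have g2 : (1 - l * l) * (k * k - 1) = 0 := by
        linear_combination -f2 - l * l * hr2
      have h : (2 * l - 1) * (k * k - 1) = 0 := by linear_combination g1 - g2
      exact sub_eq_zero.1 ((mul_eq_zero.1 h).resolve_left (sub_ne_zero.2 hlh))
    rcases mul_self_eq_one_iff.1 hr2 with rfl | rfl
    · rw [show i • a + j • c + k • x = j • c + i • a + k • x by module] at he_zero ⊢
      exact key Tsw (by linear_combination ht) (by linear_combination hs) m0 m1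
        (by linear_combination hj) (by linear_combination hr) hk2 he_zero
    · exact key T hs ht hl hl1 (by linear_combination hr) (by linear_combination hj) hk2 he_zero

/-- The algebras of type `3C(-1)` (`c ≠ 0`) and their two-dimensional quotients (`c = 0`). -/
theorem isPrimitiveAxis_of_matsuo_neg_one (T : AxisTable a c x (-1) (-1) 0 0 0 0 s t)
    (hs : 4 * s = -3) (ht : t • c = c) (h2 : (2 : F) ≠ 0) (h3 : (3 : F) ≠ 0)
    (ha : a ≠ 0) (hx : x ≠ 0) (he : e * e = e) (he_zero : e ≠ 0) :
    IsPrimitiveAxis F e := by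
  have hl0 : (-1 : F) ≠ 0 := by simp
  have hl1 : (-1 : F) ≠ 1 := fun h => h2 (by linear_combination -h)
  obtain ⟨i, j, k, rfl⟩ := T.spans e
  obtain ⟨e1, e2, e3⟩ := T.coord_of_idem hl0 hl1 he
  replace e1 := e1 ha
  replace e3 := e3 hx
  -- For `c = 0` the coordinate `j` is arbitrary, so only the vector `j • c` is determined; `t • c =
  -- c` treats both cases at once.
  have hj : j • c = (k * k) • c := by
    by_cases hc : c = 0
    · simp [hc]
    · rw [← e2 hc, (smul_left_injective F hc (by simpa using ht) : t = 1)]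
      simp
  by_cases hk : k = 0
  · subst hk
    rw [mul_zero, zero_smul] at hj
    rw [hj] at he_zero ⊢
    have hi : i = 0 ∨ i = 1 := by grind
    rcases hi with rfl | rfl
    · simp at he_zero
    · simpa using T.isPrimitiveAxis ha hl0 hl1 hl0 hl1
  · have hi : 2 * i = -1 := mul_left_cancel₀ hk (by linear_combination -e3)
    have hk2 : k * k = 1 := by
      apply mul_left_cancel₀ h3
      linear_combination k * k * hs - 4 * e1 + (2 * i - 3) * hi
    rw [hj, hk2] at he_zero ⊢
    have T₁ : AxisTable a c x (-1) (-1) 0 0 0 0 s 1 :=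
      { T with xx := by rw [T.xx, ht, one_smul] }
    have T' : AxisTable (i • a + (1 : F) • c + k • x) ((0 : F) • a + (1 : F) • c + (0 : F) • x)
        ((-3 * i) • a + (-1 : F) • c + k • x) (-1 : F) (-1) 0 0 0 0 (-3) 4 := by
      refine ⟨?_, ?_, ?_, ?_, ?_, ?_, ?_, ?_, ?_, fun z => ?_⟩
      iterate 9
        rw [T₁.mul_comb]
        match_scalars <;> grind
      obtain ⟨z₁, z₂, z₃, rfl⟩ := T.spans z
      refine ⟨-z₁ / 2 + z₃ * k * (3 / 4), z₁ + z₂ - z₃ * k / 2, z₁ / 2 + z₃ * k / 4, ?_⟩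
      match_scalars <;> grind
    exact T'.isPrimitiveAxis he_zero hl0 hl1 hl0 hl1

/-- The two-dimensional algebra with `x * x = 0`. -/
theorem isPrimitiveAxis_of_two_dim (T : AxisTable a 0 x l (1 - l) u v p q 0 t)
    (hl : l ≠ 0) (hl1 : l ≠ 1) (ha : a ≠ 0) (hx : x ≠ 0) (he : e * e = e) (he_zero : e ≠ 0) :
    IsPrimitiveAxis F e := by
  obtain ⟨i, j, k, rfl⟩ := T.spans e
  rw [show i • a + j • (0 : A) + k • x = i • a + (0 : F) • (0 : A) + k • x by simp]
    at he he_zero ⊢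
  obtain ⟨h1, -, h3⟩ := T.coord_of_idem hl hl1 he
  replace h1 := h1 ha
  replace h3 := h3 hx
  have hi : i = 1 := by
    by_contra hi
    have hi0 : i = 0 := by grind
    subst hi0
    obtain rfl : k = 0 := by linear_combination -h3
    simp at he_zero
  subst hi
  have T' : AxisTable ((1 : F) • a + (0 : F) • (0 : A) + k • x) 0 x l (1 - l) 0 0 0 0 0 0 := by
    refine ⟨he, ?_, ?_, ?_, ?_, ?_, ?_, ?_, ?_, fun z => ?_⟩
    · simp
    · simp
    · simp [add_mul, smul_mul_assoc, T.ax, T.xx]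
    · simp [mul_add, mul_smul_comm, T.xa, T.xx]
    · simp
    · simp
    · simp
    · simp [T.xx]
    · obtain ⟨z₁, z₂, z₃, rfl⟩ := T.spans z
      exact ⟨z₁, 0, z₃ - k * z₁, by simp only [smul_zero]; module⟩
  exact T'.isPrimitiveAxis he_zero hl hl1 (sub_ne_zero.2 hl1.symm) (by simpa using hl)

end AxisTable

end Idempotents

/-! ### Comparing the tables of the two axes -/

section Classification

variable {F A : Type*} [Field F] [NonUnitalNonAssocRing A] [Module F A]
  [IsScalarTower F A A] [SMulCommClass F A A] {a b c x c' y e : A}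
  {l d u v p q s t m n u' v' p' q' s' t' α β : F}

namespace AxisTable

/-- Coordinates, with respect to the table of `a`, of the relations that say that the odd
component `y` of `a` with respect to `b` is a joint eigenvector of `b`. -/
theorem coord_relations (T : AxisTable a c x l d u v p q s t)
    (T' : AxisTable b c' y m n u' v' p' q' s' t') (hl : l ≠ 0) (hl1 : l ≠ 1) (ha0 : a ≠ 0)
    (hb : b = β • a + c + x) (ha : a = α • b + c' + y) :
    (β * β + u + s = β ∧ m * (β - α * β) = n * (β - α * β) ∧
      β * (β - α * β) - α * u + (l - α) * s = m * (β - α * β)) ∧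
    (c ≠ 0 → v + t = 1 ∧ m * α = n * α ∧ -α * v + (l - α) * t = -m * α) ∧
    (x ≠ 0 → β * (l + d) + p + q = 1 ∧ m * (l - α) = n * (d - α) ∧
      β * (l - α) * l + (β - α * β) * d + (l - α) * p - α * q = m * (l - α) ∧
      (β - α * β) * l + (l - α) * β * d - α * p + (l - α) * q = n * (l - α)) := by
  have hb' : b = β • a + (1 : F) • c + (1 : F) • x := by rw [hb]; module
  have hab : a * b = α • b + n • y := T'.mul_eq_right ha
  have hba : b * a = α • b + m • y := T'.mul_eq_left ha
  rw [T.mul_eq_left hb] at hab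
  rw [T.mul_eq_right hb] at hba
  -- Both `n • y = a * b - α • b` and `m • y = b * a - α • b` are known in the table of `a`. Their
  -- proportionality gives `R1`; the eigenvector equations of `n • y` give `R2` and `R3`.
  have hY : n • y = (β - α * β) • a + (-α) • c + (l - α) • x := by
    rw [← sub_eq_iff_eq_add'.2 hab, hb]; module
  have hZ : m • y = (β - α * β) • a + (-α) • c + (d - α) • x := by
    rw [← sub_eq_iff_eq_add'.2 hba, hb]; module
  have R0 := T'.aa
  rw [hb', T.mul_comb] at R0
  have R1 : (m * (β - α * β)) • a + (m * -α) • c + (m * (l - α)) • x =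
      (n * (β - α * β)) • a + (n * -α) • c + (n * (d - α)) • x := by
    have h : m • (n • y) = n • (m • y) := by module
    rw [hY, hZ] at h
    calc _ = _ := by module
      _ = _ := h
      _ = _ := by module
  have R2 : b * (n • y) = m • (n • y) := by rw [mul_smul_comm, T'.ax]; module
  rw [hY, hb', T.mul_comb, smul_add, smul_add, smul_smul, smul_smul, smul_smul] at R2
  have R3 : (n • y) * b = n • (n • y) := by rw [smul_mul_assoc, T'.xa]
  rw [hY, hb', T.mul_comb, smul_add, smul_add, smul_smul, smul_smul, smul_smul] at R3
  obtain ⟨a0, c0, x0⟩ := T.comb_inj hl hl1 R0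
  obtain ⟨a1, c1, x1⟩ := T.comb_inj hl hl1 R1
  obtain ⟨a2, c2, x2⟩ := T.comb_inj hl hl1 R2
  obtain ⟨a3, c3, x3⟩ := T.comb_inj hl hl1 R3
  refine ⟨⟨?_, a1 ha0, ?_⟩, fun hc => ⟨?_, ?_, ?_⟩, fun hx => ⟨?_, x1 hx, ?_, ?_⟩⟩
  · linear_combination a0 ha0
  · linear_combination a2 ha0
  · linear_combination c0 hc
  · linear_combination -c1 hc
  · linear_combination c2 hc
  · linear_combination x0 hx
  · linear_combination x2 hx
  · linear_combination x3 hx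

/-- If `c'` or `y` vanished, `a * b` would be a combination of `a` and `b`, hence have equal
coordinates at `c` and `x`; but these are 0 and `l`. -/
theorem ne_zero_of_ne_zero (T : AxisTable a c x l d u v p q s t)
    (T' : AxisTable b c' y m n u' v' p' q' s' t') (hl : l ≠ 0) (hl1 : l ≠ 1)
    (hb : b = β • a + c + x) (ha : a = α • b + c' + y) (hc : c ≠ 0) (hx : x ≠ 0) :
    c' ≠ 0 ∧ y ≠ 0 := by
  have hab : a * b = α • b + n • y := T'.mul_eq_right ha
  rw [T.mul_eq_left hb] at hab
  constructor
  · rintro rfl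
    have hy : y = a - α • b := by rw [eq_sub_iff_add_eq', ← add_zero (α • b)]; exact ha.symm
    have h : (β : F) • a + (0 : F) • c + l • x =
        (α * β + n * (1 - α * β)) • a + (α - n * α) • c + (α - n * α) • x := by
      rw [zero_smul, add_zero, hab, hy, hb]; module
    obtain ⟨-, h1, h2⟩ := T.comb_inj hl hl1 h
    exact hl ((h2 hx).trans (h1 hc).symm)
  · rintro rfl
    have h : (β : F) • a + (0 : F) • c + l • x = (α * β) • a + α • c + α • x := by
      rw [zero_smul, add_zero, hab, hb]; module
    obtain ⟨-, h1, h2⟩ := T.comb_inj hl hl1 h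
    exact hl ((h2 hx).trans (h1 hc).symm)

/-- The conclusion says that `b = c` is an idempotent orthogonal to `a`. The relations give `α = 0`;
if `β ≠ 0`, they give `β = m`, so `y = a` and `c' = 0`, and `a = y * y` would be a multiple of `b`,
contradicting `c ≠ 0`. -/
theorem mul_eq_zero_of_odd_eq_zero (T : AxisTable a c 0 l d u v p q s t)
    (T' : AxisTable b c' y m n u' v' p' q' s' t') (hl : l ≠ 0) (hl1 : l ≠ 1) (hm1 : m ≠ 1)
    (ha0 : a ≠ 0) (hc : c ≠ 0) (hb : b = β • a + c + 0) (ha : a = α • b + c' + y) :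
    β = 0 ∧ u = 0 ∧ v = 1 := by
  have hxx : s • a + t • c + (0 : F) • (0 : A) = (0 : F) • a + (0 : F) • c + (0 : F) • (0 : A) := by
    rw [← T.xx]; simp
  obtain ⟨h1, h2, -⟩ := T.comb_inj hl hl1 hxx
  obtain rfl := h1 ha0
  obtain rfl := h2 hc
  obtain ⟨⟨r0, r1, r2⟩, h, -⟩ := T.coord_relations T' hl hl1 ha0 hb ha
  obtain ⟨k0, k1, k2⟩ := h hc
  obtain rfl : v = 1 := by linear_combination k0
  have hα : α = 0 := by
    have : α * (1 - m) = 0 := by linear_combination -k2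
    exact (mul_eq_zero.1 this).resolve_right (sub_ne_zero.2 hm1.symm)
  subst hα
  have hβ : β = 0 := by
    by_contra hβ
    have hm : β = m := mul_right_cancel₀ hβ (by linear_combination r2)
    have hba : b * a = (0 : F) • b + m • y := T'.mul_eq_left ha
    rw [T.mul_eq_right hb, ← hm, smul_zero, add_zero, zero_smul, zero_add] at hba
    have hy : a = y := smul_right_injective A hβ hba
    have hc' : c' = 0 := by
      rw [← hy, zero_smul, zero_add] at ha
      simpa using ha
    have hyy := T'.xx
    rw [← hy, hc', T.aa, smul_zero, add_zero, hb] at hyy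
    have hz : (1 : F) • a + (0 : F) • c + (0 : F) • (0 : A) =
        (s' * β) • a + s' • c + (0 : F) • (0 : A) := by
      rw [one_smul, zero_smul, zero_smul, add_zero, add_zero]
      conv_lhs => rw [hyy]
      module
    obtain ⟨z1, z2, -⟩ := T.comb_inj hl hl1 hz
    have := z1 ha0
    rw [← z2 hc, zero_mul] at this
    exact one_ne_zero this
  subst hβ
  exact ⟨rfl, by linear_combination r0 , rfl⟩

/-- The structure constants of `A` when `A` is commutative and three-dimensional. -/
theorem coeff_of_comm (T : AxisTable a c x l l u v p q s t)
    (T' : AxisTable b c' y m m u' v' p' q' s' t') (hl : l ≠ 0) (hl1 : l ≠ 1) (ha0 : a ≠ 0)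
    (hb : b = β • a + c + x) (ha : a = α • b + c' + y) (hc : c ≠ 0) (hx : x ≠ 0) :
    p = q ∧ 2 * p = 1 - 2 * β * l ∧ 2 * t = 1 + 2 * β - 2 * m ∧ v = 1 - t ∧
      l * t = α * (1 - m) ∧ l * s = β * (l * t - β + m) ∧ u = β - β * β - s := by
  obtain ⟨⟨r0, r1, r2⟩, h, h'⟩ := T.coord_relations T' hl hl1 ha0 hb ha
  obtain ⟨k0, k1, k2⟩ := h hc
  obtain ⟨x0, x1, x2, x3⟩ := h' hx
  obtain rfl : p = q := mul_left_cancel₀ hl (by linear_combination x2 - x3)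
  have hp : 2 * p = 1 - 2 * β * l := by linear_combination x0
  obtain rfl : v = 1 - t := by linear_combination k0
  have hlt : l * t = α * (1 - m) := by linear_combination k2
  obtain rfl : u = β - β * β - s := by linear_combination r0
  refine ⟨rfl, hp, ?_, rfl, hlt, ?_, rfl⟩
  · apply mul_left_cancel₀ hl
    linear_combination 2 * hlt - 2 * x2 + (l - 2 * α) * hp
  · linear_combination r2 - β * hlt

/-- The square of `a * b = β • a + l • x = α • b + m • y` is computed in both tables. Subtracting
the `x`-coordinate from the `c`-coordinate removes the multiple of `b`, and with it `s` and `s'`. -/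
theorem square_relation (T : AxisTable a c x l l u v p q s t)
    (T' : AxisTable b c' y m m u' v' p' q' s' t') (hl : l ≠ 0) (hl1 : l ≠ 1)
    (hb : b = β • a + c + x) (ha : a = α • b + c' + y) (hc : c ≠ 0) (hx : x ≠ 0) :
    2 * β * l - l * t = 2 * α * m - m * t' := by
  have hg : β • a + l • x = α • b + m • y := by
    rw [← T.mul_eq_left hb, T'.mul_eq_right ha]
  have hY : m • y = (β - α * β) • a + (-α) • c + (l - α) • x := by
    rw [← sub_eq_iff_eq_add'.2 hg, hb]; module
  have hC : m • c' = (m - m * α * β - (β - α * β)) • a + (-m * α + α) • c +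
      (-m * α - (l - α)) • x := by
    have : m • c' = m • a - (m * α) • b - m • y := by
      have hc' : c' = a - α • b - y := by rw [ha]; abel
      rw [hc']; module
    rw [this, hY, hb]; module
  have h1 : (β • a + l • x) * (β • a + l • x) =
      (β * β + l * l * s) • a + (l * l * t) • c + (2 * β * l * l) • x := by
    have := T.mul_comb β 0 l β 0 l
    rw [zero_smul, add_zero] at this
    rw [this]; module
  have h2 : (α • b + m • y) * (α • b + m • y) =
      (α * α + m * m * s') • b + (m * t') • (m • c') + (2 * α * m) • (m • y) := by
    have := T'.mul_comb α 0 m α 0 m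
    rw [zero_smul, add_zero] at this
    rw [this]; module
  rw [hg, h2, hC, hY, hb] at h1
  have h3 := Eq.trans (by module :
    ((α * α + m * m * s') * β + m * t' * (m - m * α * β - (β - α * β)) +
        2 * α * m * (β - α * β)) • a +
      (α * α + m * m * s' + m * t' * (-m * α + α) + 2 * α * m * -α) • c +
      (α * α + m * m * s' + m * t' * (-m * α - (l - α)) + 2 * α * m * (l - α)) • x = _) h1
  obtain ⟨-, k1, k2⟩ := T.comb_inj hl hl1 h3
  apply mul_left_cancel₀ hl
  linear_combination k1 hc - k2 hx

end AxisTable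

end Classification

/-! ### The cases of the classification -/

section Main

variable {F A : Type*} [Field F] [NonUnitalNonAssocRing A] [Module F A]
  [IsScalarTower F A A] [SMulCommClass F A A] {a b c x c' y e : A}
  {l d u v p q s t m n u' v' p' q' s' t' α β : F}

namespace AxisTable

/-- The structure constants of the two tables and the square relation are three linear equations in
`α` and `β`; their compatibility is `(l - m) * (1 - l - m) = 0`. -/
theorem type_relations (T : AxisTable a c x l l u v p q s t)
    (T' : AxisTable b c' y m m u' v' p' q' s' t') (hl : l ≠ 0) (hl1 : l ≠ 1)
    (hm : m ≠ 0) (hm1 : m ≠ 1) (ha0 : a ≠ 0) (hb0 : b ≠ 0)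
    (hb : b = β • a + c + x) (ha : a = α • b + c' + y) (hc : c ≠ 0) (hx : x ≠ 0) :
    2 * β * (1 - 2 * l) = 2 * m - 2 * l * m - l ∧
      (2 * l = 1 ∧ 2 * m = 1 ∨ 2 * l ≠ 1 ∧ (l = m ∨ l + m = 1)) := by
  obtain ⟨hc', hy⟩ := T.ne_zero_of_ne_zero T' hl hl1 hb ha hc hx
  obtain ⟨-, -, ht, -, hlt, -, -⟩ := T.coeff_of_comm T' hl hl1 ha0 hb ha hc hx
  obtain ⟨-, -, ht', -, hmt, -, -⟩ := T'.coeff_of_comm T hm hm1 hb0 ha hb hc' hy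
  have hsq := T.square_relation T' hl hl1 hb ha hc hx
  have e1 : 2 * α * (1 - m) = l * (1 + 2 * β - 2 * m) := by
    rw [← ht]; linear_combination -2 * hlt
  have e2 : 2 * β * (1 - l) = m * (1 + 2 * α - 2 * l) := by
    rw [← ht']; linear_combination -2 * hmt
  have e3 : l * (2 * β - 1) = m * (2 * α - 1) := by
    linear_combination 2 * hsq + l * ht - m * ht'
  have hβ : 2 * β * (1 - 2 * l) = 2 * m - 2 * l * m - l := by linear_combination e2 - e3
  have hα : 2 * α * (1 - 2 * m) = 2 * l - 2 * l * m - m := by linear_combination e1 + e3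
  refine ⟨hβ, ?_⟩
  by_cases h : 2 * l = 1
  · exact .inl ⟨h, by linear_combination (2 * m + 1 - 4 * β) * h - 2 * hβ⟩
  · refine .inr ⟨h, ?_⟩
    have key : (l - m) * (1 - l - m) = 0 := by
      linear_combination (-(1 - 2 * l) * (1 - 2 * m)) * e3 + l * (1 - 2 * m) * hβ -
        m * (1 - 2 * l) * hα
    rcases mul_eq_zero.1 key with k | k
    · exact .inl (sub_eq_zero.1 k)
    · exact .inr (by linear_combination -k)

theorem isPrimitiveAxis_of_comm (T : AxisTable a c x l l u v p q s t)
    (T' : AxisTable b c' y m m u' v' p' q' s' t') (h2 : (2 : F) ≠ 0) (hl : l ≠ 0) (hl1 : l ≠ 1)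
    (hm : m ≠ 0) (hm1 : m ≠ 1) (ha0 : a ≠ 0) (hb0 : b ≠ 0)
    (hb : b = β • a + c + x) (ha : a = α • b + c' + y) (hc : c ≠ 0) (hx : x ≠ 0)
    (he : e * e = e) (he_zero : e ≠ 0) (he_one : ¬ ∀ z : A, e * z = z ∧ z * e = z) :
    IsPrimitiveAxis F e := by
  obtain ⟨rfl, hp, ht, rfl, -, hs, hu⟩ := T.coeff_of_comm T' hl hl1 ha0 hb ha hc hx
  obtain ⟨hβ, h⟩ := T.type_relations T' hl hl1 hm hm1 ha0 hb0 hb ha hc hx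
  rcases h with ⟨hlh, hmh⟩ | ⟨hlh, h⟩
  · obtain rfl : t = β := mul_left_cancel₀ h2 (by linear_combination ht - hmh)
    obtain rfl : s = t * (1 - t) := by
      linear_combination 2 * hs - (s - t * t) * hlh + t * hmh
    obtain rfl : u = 0 := by linear_combination hu
    obtain rfl : p = (1 - t) * l := by
      linear_combination l * hp - (p + l * t) * hlh
    -- Here `β = t` is a free parameter; at `t = 1` one has `c * c = 0` and `c` cannot be
    -- normalised.
    by_cases h1 : t = 1
    · subst h1
      simp only [sub_self, zero_mul, mul_zero] at T
      exact T.isPrimitiveAxis_of_jordan_nonunital hlh ha0 hc hx he he_zero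
    · have hv : 1 - t ≠ 0 := sub_ne_zero.2 (Ne.symm h1)
      have T₁ := T.rescale hv
      rw [inv_mul_cancel_left₀ hv, mul_comm t] at T₁
      exact T₁.isPrimitiveAxis_of_jordan hlh ha0 (smul_ne_zero (inv_ne_zero hv) hc) hx he
        he_zero he_one
  · have hl2 : 1 - 2 * l ≠ 0 := sub_ne_zero.2 (Ne.symm hlh)
    have reduce (hs4 : 4 * s = l * (2 - l)) (hu0 : u = 0) (hp1 : p = (1 - t) * (1 - l))
        (ht4 : 4 * ((1 - t) * t) = 1 - l * l) (hv : 1 - t ≠ 0) : IsPrimitiveAxis F e := by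
      subst hu0 hp1
      have T₁ := T.rescale hv
      rw [inv_mul_cancel_left₀ hv] at T₁
      exact T₁.isPrimitiveAxis_of_matsuo hs4 ht4 h2 hlh hl hl1 ha0
        (smul_ne_zero (inv_ne_zero hv) hc) hx he he_zero he_one
    have h4 : (4 : F) ≠ 0 := by
      rw [show (4 : F) = 2 * 2 by norm_num]; exact mul_ne_zero h2 h2
    rcases h with rfl | h
    · have hβ2 : 2 * β = l := mul_right_cancel₀ hl2 (by linear_combination hβ)
      have ht2 : 2 * t = 1 - l := by linear_combination ht + hβ2
      have hs4 : 4 * s = l * (2 - l) := mul_left_cancel₀ hl (by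
        linear_combination 4 * hs + 2 * β * l * ht2 + (l * (1 - l) + l - 2 * β) * hβ2)
      have hu0 : u = 0 := mul_left_cancel₀ h4 (by
        linear_combination 4 * hu - hs4 + (2 - 2 * β - l) * hβ2)
      -- As `1 + l = 2 * (1 - t)`, this is the case `c * c = 0`.
      by_cases hl' : 1 + l = 0
      · obtain rfl : l = -1 := by linear_combination hl'
        obtain rfl : t = 1 := mul_left_cancel₀ h2 (by linear_combination ht2)
        obtain rfl : p = 0 := mul_left_cancel₀ h2 (by linear_combination hp + hβ2)
        subst hu0
        rw [sub_self] at T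
        exact T.isPrimitiveAxis_of_matsuo_neg_one (by linear_combination hs4) (one_smul F c) h2
          (fun h3 => hlh (by linear_combination -h3)) ha0 hx he he_zero
      · have hv2 : 2 * (1 - t) = 1 + l := by linear_combination -ht2
        refine reduce hs4 hu0 ?_ ?_ ?_
        · exact mul_left_cancel₀ h2 (by linear_combination hp - l * hβ2 - (1 - l) * hv2)
        · linear_combination 2 * t * hv2 + (1 + l) * ht2
        · intro h
          exact hl' (by rw [← hv2, h, mul_zero])
    · obtain rfl : m = 1 - l := by linear_combination h
      have hβ2 : 2 * β = 2 - l := mul_right_cancel₀ hl2 (by linear_combination hβ)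
      have ht2 : 2 * t = 1 + l := by linear_combination ht + hβ2
      have hv2 : 2 * (1 - t) = 1 - l := by linear_combination -ht2
      have hs4 : 4 * s = l * (2 - l) := mul_left_cancel₀ hl (by
        linear_combination 4 * hs + 2 * β * l * ht2 + (l * l - 2 * β) * hβ2)
      refine reduce hs4 ?_ ?_ ?_ ?_
      · exact mul_left_cancel₀ h4 (by
          linear_combination 4 * hu - hs4 + (2 - 2 * β - (2 - l)) * hβ2)
      · exact mul_left_cancel₀ h2 (by linear_combination hp - l * hβ2 - (1 - l) * hv2)
      · linear_combination 2 * t * hv2 + (1 - l) * ht2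
      · intro h
        rw [h, mul_zero] at hv2
        exact hl1 (by linear_combination hv2)

theorem isPrimitiveAxis_of_three_dim (T : AxisTable a c x l d u v p q s t)
    (T' : AxisTable b c' y m n u' v' p' q' s' t') (h2 : (2 : F) ≠ 0) (hl : l ≠ 0) (hl1 : l ≠ 1)
    (hm : m ≠ 0) (hm1 : m ≠ 1) (ha0 : a ≠ 0) (hb0 : b ≠ 0)
    (hb : b = β • a + c + x) (ha : a = α • b + c' + y) (hc : c ≠ 0) (hx : x ≠ 0)
    (he : e * e = e) (he_zero : e ≠ 0) (he_one : ¬ ∀ z : A, e * z = z ∧ z * e = z) :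
    IsPrimitiveAxis F e := by
  obtain ⟨hc', hy⟩ := T.ne_zero_of_ne_zero T' hl hl1 hb ha hc hx
  obtain ⟨⟨r0, r1, r2⟩, h, h'⟩ := T.coord_relations T' hl hl1 ha0 hb ha
  obtain ⟨k0, k1, k2⟩ := h hc
  obtain ⟨x0, x1, x2, x3⟩ := h' hx
  -- Equality of the eigenvalues of `b` forces `l = d`, the commutative case. Otherwise the
  -- relations give `α = β = 0`, and the two tables determine all constants through `l`.
  by_cases hmn : m = n
  · subst hmn
    obtain rfl : l = d := by linear_combination mul_left_cancel₀ hm x1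
    exact T.isPrimitiveAxis_of_comm T' h2 hl hl1 hm hm1 ha0 hb0 hb ha hc hx he he_zero he_one
  · have hα : α = 0 := by
      have : (m - n) * α = 0 := by linear_combination k1
      exact (mul_eq_zero.1 this).resolve_left (sub_ne_zero.2 hmn)
    subst hα
    have hβ : β = 0 := by
      have : (m - n) * β = 0 := by linear_combination r1
      exact (mul_eq_zero.1 this).resolve_left (sub_ne_zero.2 hmn)
    subst hβ
    obtain rfl : p = m := mul_left_cancel₀ hl (by linear_combination x2)
    obtain rfl : q = n := mul_left_cancel₀ hl (by linear_combination x3)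
    obtain rfl : s = 0 := mul_left_cancel₀ hl (by linear_combination r2)
    obtain rfl : t = 0 := mul_left_cancel₀ hl (by linear_combination k2)
    obtain rfl : v = 1 := by linear_combination k0
    obtain rfl : u = 0 := by linear_combination r0
    obtain ⟨-, -, hf⟩ := T'.coord_relations T hm hm1 hb0 ha hb
    obtain ⟨z0, z1, z2, z3⟩ := hf hy
    obtain rfl : p' = l := mul_left_cancel₀ hm (by linear_combination z2)
    obtain rfl : q' = d := mul_left_cancel₀ hm (by linear_combination z3)
    obtain rfl : q' = 1 - p' := by linear_combination z0
    obtain rfl : q = 1 - p := by linear_combination x0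
    obtain rfl : p = 1 - p' := by linear_combination x1
    rw [sub_sub_cancel] at T
    exact T.isPrimitiveAxis_of_xx_zero hl hl1 ha0 hc hx he he_zero he_one

/-- The component `c'` vanishes too, and the relations become symmetric: `α * (2 * β - 1) = 1 = β *
(2 * α - 1)`. So `α = β` is 1, where `x * x = 0`, or -1/2, where `l = d = -1`. -/
theorem isPrimitiveAxis_of_even_eq_zero (T : AxisTable a 0 x l d u v p q s t)
    (T' : AxisTable b c' y m n u' v' p' q' s' t') (h2 : (2 : F) ≠ 0) (hl : l ≠ 0) (hl1 : l ≠ 1)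
    (hm : m ≠ 0) (hm1 : m ≠ 1) (ha0 : a ≠ 0) (hb0 : b ≠ 0)
    (hb : b = β • a + 0 + x) (ha : a = α • b + c' + y) (hx : x ≠ 0)
    (he : e * e = e) (he_zero : e ≠ 0) : IsPrimitiveAxis F e := by
  have hab : a * b = α • b + n • y := T'.mul_eq_right ha
  have hba : b * a = α • b + m • y := T'.mul_eq_left ha
  have hba' := T.mul_eq_right hb
  have hab' := T.mul_eq_left hb
  have hy : y ≠ 0 := by
    rintro rfl
    rw [hab, smul_zero, add_zero, hb] at hab'
    by_cases hc' : c' = 0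
    · rw [hc', hb] at ha
      have h : (1 : F) • a + (0 : F) • (0 : A) + (0 : F) • x =
          (α * β) • a + (0 : F) • (0 : A) + α • x := by
        rw [one_smul, zero_smul, zero_smul, add_zero, add_zero]
        conv_lhs => rw [ha]
        simp only [add_zero, smul_add, smul_smul]
      obtain ⟨h1, -, h3⟩ := T.comb_inj hl hl1 h
      have := h1 ha0
      rw [← h3 hx, zero_mul] at this
      exact one_ne_zero this
    · obtain ⟨rfl, -, -⟩ := T'.mul_eq_zero_of_odd_eq_zero T hm hm1 hl1 hb0 hc' ha hb
      have h : β • a + (0 : F) • (0 : A) + l • x = (0 : F) • a + (0 : F) • (0 : A) + (0 : F) • x := by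
        rw [smul_zero, add_zero, ← hab']; module
      exact hl ((T.comb_inj hl hl1 h).2.2 hx)
  have hc' : c' = 0 := by
    by_contra hc'
    exact (T'.ne_zero_of_ne_zero T hm hm1 ha hb hc' hy).1 rfl
  subst hc'
  have hY : y = (1 - α * β) • a + (0 : F) • (0 : A) + (-α) • x := by
    have : y = a - α • b := by rw [eq_sub_iff_add_eq', ← add_zero (α • b)]; exact ha.symm
    rw [this, hb]; module
  rw [hab, hY, hb] at hab'
  rw [hba, hY, hb] at hba'
  have f1 : (α * β + n * (1 - α * β)) • a + (0 : F) • (0 : A) + (α - n * α) • x =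
      β • a + (0 : F) • (0 : A) + l • x := by
    rw [smul_zero, add_zero (β • a), ← hab']; module
  have f2 : (α * β + m * (1 - α * β)) • a + (0 : F) • (0 : A) + (α - m * α) • x =
      β • a + (0 : F) • (0 : A) + d • x := by
    rw [smul_zero, add_zero (β • a), ← hba']; module
  obtain ⟨g1, -, g2⟩ := T.comb_inj hl hl1 f1
  obtain ⟨g3, -, g4⟩ := T.comb_inj hl hl1 f2
  replace g1 := g1 ha0
  replace g2 := g2 hx
  replace g3 := g3 ha0
  replace g4 := g4 hx
  have hp : p = 0 := by
    have := T.cx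
    rw [zero_mul] at this
    exact (smul_eq_zero.1 this.symm).resolve_right hx
  have hq : q = 0 := by
    have := T.xc
    rw [mul_zero] at this
    exact (smul_eq_zero.1 this.symm).resolve_right hx
  have hu : u = 0 := by
    have := T.cc
    rw [mul_zero, smul_zero, add_zero] at this
    exact (smul_eq_zero.1 this.symm).resolve_right ha0
  have hp' : p' = 0 := by
    have := T'.cx
    rw [zero_mul] at this
    exact (smul_eq_zero.1 this.symm).resolve_right hy
  have hq' : q' = 0 := by
    have := T'.xc
    rw [mul_zero] at this
    exact (smul_eq_zero.1 this.symm).resolve_right hy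
  subst hp hq hu hp' hq'
  obtain ⟨⟨r0, -, -⟩, -, h⟩ := T.coord_relations T' hl hl1 ha0 hb ha
  obtain ⟨-, -, h'⟩ := T'.coord_relations T hm hm1 hb0 ha hb
  obtain ⟨x0, -, -, -⟩ := h hx
  obtain ⟨y0, -, -, -⟩ := h' hy
  have hn' : n = β * (1 - l) := by linear_combination g1 - β * g2
  have hm' : m = β * (1 - d) := by linear_combination g3 - β * g4
  have e1 : α * (2 * β - 1) = 1 := by linear_combination y0 - α * hn' - α * hm' + α * x0
  have e2 : β * (2 * α - 1) = 1 := by linear_combination x0 + β * g2 + β * g4 + β * y0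
  obtain rfl : α = β := by linear_combination e2 - e1
  by_cases hα1 : α = 1
  · subst hα1
    obtain rfl : s = 0 := by linear_combination r0
    obtain rfl : d = 1 - l := by linear_combination x0
    exact T.isPrimitiveAxis_of_two_dim hl hl1 ha0 hx he he_zero
  · have hα2 : 2 * α = -1 := mul_left_cancel₀ (sub_ne_zero.2 hα1) (by linear_combination e1)
    -- In characteristic 3 the two roots 1 and -1/2 coincide.
    have h3 : (3 : F) ≠ 0 := fun h => hα1 (by linear_combination α * h - hα2)
    obtain rfl : d = -1 := mul_left_cancel₀ h3 (by
      rw [hm'] at g4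
      linear_combination -4 * g4 + (2 - (1 - d) * (2 * α - 1)) * hα2)
    obtain rfl : l = -1 := mul_left_cancel₀ h3 (by
      rw [hn'] at g2
      linear_combination -4 * g2 + (2 - (1 - l) * (2 * α - 1)) * hα2)
    have T₁ : AxisTable a 0 x (-1) (-1) 0 0 0 0 s t := { T with cc := by simp }
    exact T₁.isPrimitiveAxis_of_matsuo_neg_one
      (by linear_combination 4 * r0 + (3 - 2 * α) * hα2) (smul_zero t) h2 h3 ha0 hx he he_zero

end AxisTable

end Main

theorem mainTheorem9 {F A : Type*} [Field F] (hchar : ringChar F ≠ 2)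
    [NonUnitalNonAssocRing A] [Module F A] [IsScalarTower F A A] [SMulCommClass F A A]
    (a b : A) (ha : IsPrimitiveAxis F a) (hb : IsPrimitiveAxis F b)
    (hgen : NonUnitalAlgebra.adjoin F ({a, b} : Set A) = ⊤)
    (e : A) (he : e * e = e) (he_zero : e ≠ 0)
    (he_one : ¬ ∀ x : A, e * x = x ∧ x * e = x) :
    IsPrimitiveAxis F e := by
  have h2 : (2 : F) ≠ 0 := Ring.two_ne_zero hchar
  obtain ⟨l, d, hA⟩ := id ha
  obtain ⟨m, n, hB⟩ := id hb
  obtain ⟨β, c, x, u, v, p, q, s, t, T, hbe⟩ := hA.exists_axisTable hB hgen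
  obtain ⟨α, c', y, u', v', p', q', s', t', T', hae⟩ :=
    hB.exists_axisTable hA (by rwa [Set.pair_comm])
  have ha0 := hA.left.ne_zero
  have hb0 := hB.left.ne_zero
  have hl := hA.left.lam_ne_zero
  have hl1 := hA.left.lam_ne_one
  have hm := hB.left.lam_ne_zero
  have hm1 := hB.left.lam_ne_one
  by_cases hc : c = 0
  · subst hc
    by_cases hx : x = 0
    · subst hx
      obtain ⟨i, j, k, rfl⟩ := T.spans e
      simp only [smul_zero, add_zero] at he he_zero ⊢
      rw [smul_mul_assoc, mul_smul_comm, T.aa, smul_smul] at he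
      have h : i * i = i := smul_left_injective F ha0 he
      have hi : i = 0 ∨ i = 1 := by grind
      rcases hi with rfl | rfl
      · simp at he_zero
      · simpa using ha
    · exact T.isPrimitiveAxis_of_even_eq_zero T' h2 hl hl1 hm hm1 ha0 hb0 hbe
        hae hx he he_zero
  · by_cases hx : x = 0
    · subst hx
      -- Now `A` is `F × F`, whose only idempotents are 0, `a`, `b` and the identity `a + b`.
      obtain ⟨rfl, rfl, rfl⟩ := T.mul_eq_zero_of_odd_eq_zero T' hl hl1 hm1 ha0 hc hbe hae
      obtain rfl : b = c := by simpa using hbe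
      obtain ⟨i, j, k, rfl⟩ := T.spans e
      obtain ⟨h, h', -⟩ := T.coord_of_idem hl hl1 he
      replace h := h ha0
      replace h' := h' hc
      have hxx : s • a + t • b + (0 : F) • (0 : A) =
          (0 : F) • a + (0 : F) • b + (0 : F) • (0 : A) := by
        rw [← T.xx]; simp
      obtain ⟨hs, ht, -⟩ := T.comb_inj hl hl1 hxx
      rw [hs ha0] at h
      rw [ht hc] at h'
      have hi : i = 0 ∨ i = 1 := by grind
      have hj : j = 0 ∨ j = 1 := by grind
      rcases hi with rfl | rfl <;> rcases hj with rfl | rfl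
      · simp at he_zero
      · simpa using hb
      · simpa using ha
      · refine absurd (fun z => ?_) he_one
        obtain ⟨z₁, z₂, z₃, rfl⟩ := T.spans z
        simp [mul_add, add_mul, T.aa, T.ac, T.ca, T.cc, mul_smul_comm, smul_mul_assoc]
    · exact T.isPrimitiveAxis_of_three_dim T' h2 hl hl1 hm hm1 ha0 hb0 hbe hae hc hx he he_zero
        he_one
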